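/- All graphs are finite, simple and nonempty. A graph $H$ is a \emph{cyclic minor} of a graph $G$ if a graph isomorphic to $H$ can be obtained from some subgraph $S$ of $G$ having a Hamiltonian cycle $C$ by contracting some of the edges of $C$ (loops and parallel edges arising from the contraction are discarded). For $\ell \ge 1$, let $f(\ell)$ be the smallest non-negative integer $\delta$ such that every graph of minimum degree at least $\delta$ contains the complete graph $K_\ell$ as a cyclic minor. Then $f(3)=2$, $f(4)=3$, and $f(5)$ is well defined with $f(5)\le 8$. -/

import Mathlib

universe u v

/-- The graph `G / X` obtained from `G` by contracting the edges of `X`: its vertices are the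
connected components of the spanning graph with edge set `X`, and two distinct components are
adjacent when some edge of `G` joins them (loops and parallel edges are discarded). -/
def SimpleGraph.contractEdges {V : Type u} (G : SimpleGraph V) (X : Set (Sym2 V)) :
    SimpleGraph (SimpleGraph.fromEdgeSet X).ConnectedComponent :=
  G.map (SimpleGraph.fromEdgeSet X).connectedComponentMk

open Classical in
/-- `H` is a cyclic minor of `G`: some subgraph `S` of `G` has a Hamiltonian cycle `c` such that
contracting in `S` a set `X` of edges of `c` yields a graph isomorphic to `H`. -/
def SimpleGraph.IsCyclicMinor {W : Type v} {V : Type u}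
    (H : SimpleGraph W) (G : SimpleGraph V) : Prop :=
  ∃ (S : G.Subgraph) (a : S.verts) (c : S.coe.Walk a a) (X : Set (Sym2 S.verts)),
    c.IsHamiltonianCycle ∧ (∀ e ∈ X, e ∈ c.edges) ∧ Nonempty (H ≃g S.coe.contractEdges X)

/-- The set of all `δ` such that every finite nonempty graph of minimum degree at least `δ`
contains the complete graph on `ℓ` vertices as a cyclic minor.
Its least element is `f(ℓ)`. -/
def cyclicCliqueForcing (ℓ : ℕ) : Set ℕ :=
  {δ | ∀ (V : Type u) [Fintype V] [Nonempty V] (G : SimpleGraph V) [DecidableRel G.Adj],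
    δ ≤ G.minDegree → (⊤ : SimpleGraph (Fin ℓ)).IsCyclicMinor G}

/-! The complete graph on `ℓ - 1` vertices has minimum degree `ℓ - 2` and too few vertices for a
`K_ℓ` minor; this gives the lower bounds. For the upper bounds, the vertices of a cycle are listed
as `0, …, n - 1`, cut into consecutive intervals, and each interval is contracted (`IsCliqueModel`).

For `K₃` any cycle will do. For `K₄` two crossing chords suffice; they come from one rotation of a
longest path whose first vertex has its farthest neighbour as near as possible.

For `K₅`, take a longest path with a longest initial segment closed into a cycle by a chord at the
first vertex. Let `U` be the set of vertices that Pósa rotations of this segment bring to the front.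
Their neighbours all lie on the segment. Rotations never break a run of vertices outside `U`, so a
vertex of `U` has at most one neighbour in each run (`eq_of_adj_of_mem_run`), and is not adjacent to
the vertex just after a run that follows it (`not_adj_of_run`). Let `m = |U|`, let `I` and `O` count
the edges inside `U` and leaving `U`, let `D` be the number of runs and `A ≥ D - 1` the number of
runs followed by an element of `U`. Contracting each run gives a path on `m + D` vertices with at
least `I + O` edges; absorbing each run into its predecessor gives `m` vertices and at least `I + A`
edges. By `exists_isCliqueModel_five`, an induction in the style of Mader, a graph on a Hamiltonian
path of `N ≥ 3` vertices that does not contract along it to `K₅` has at most `3N - 6` edges. Hence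
`8m ≤ 2I + O ≤ 6m + 3D - A - 12 ≤ 6m + 2D - 11`, contradicting `D ≤ m`. -/

namespace SimpleGraph

/-! ### Cyclic minors from interval partitions of a cycle -/

/-- A walk of length `k` running along consecutive values of `q`. -/
theorem exists_walk_of_forall_adj_succ {α : Type u} {G : SimpleGraph α} (q : ℕ → α) :
    ∀ k : ℕ, (∀ i < k, G.Adj (q i) (q (i + 1))) →
      ∃ w : G.Walk (q 0) (q k), w.support = (List.range (k + 1)).map q ∧
        w.edges = (List.range k).map fun i => s(q i, q (i + 1))
  | 0, _ => ⟨Walk.nil, by simp, by simp⟩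
  | k + 1, h => by
    obtain ⟨w, hs, he⟩ := exists_walk_of_forall_adj_succ q k fun i hi => h i (by omega)
    refine ⟨w.concat (h k (by omega)), ?_, ?_⟩
    · rw [Walk.support_concat, hs, List.range_succ (n := k + 1)]
      simp
    · rw [Walk.edges_concat, he, List.range_succ (n := k)]
      simp

theorem Walk.isHamiltonianCycle_cons {α : Type u} [DecidableEq α] {G : SimpleGraph α} {a b : α}
    (h : G.Adj a b) (w : G.Walk b a) (hn : w.support.Nodup) (hm : ∀ v, v ∈ w.support)
    (he : s(a, b) ∉ w.edges) : (Walk.cons h w).IsHamiltonianCycle := by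
  rw [Walk.isHamiltonianCycle_iff_isCycle_and_support_count_tail_eq_one]
  refine ⟨(Walk.cons_isCycle_iff _ _).2 ⟨Walk.IsPath.mk' hn, he⟩, fun v => ?_⟩
  exact List.count_eq_one_of_mem hn (hm v)

/-- The first `n` values of `p` form, in this order, a cycle of `G`. -/
structure IsCyclicSeq {V : Type u} (G : SimpleGraph V) (n : ℕ) (p : ℕ → V) : Prop where
  three_le : 3 ≤ n
  inj : ∀ i < n, ∀ j < n, p i = p j → i = j
  adj : ∀ i, i + 1 < n → G.Adj (p i) (p (i + 1))
  close : G.Adj (p (n - 1)) (p 0)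

/-- Cutting `0, …, n - 1` into `ℓ` consecutive intervals, the fibres of `g`, so that any two
of them are joined by an edge of `G`. -/
structure IsCliqueModel (G : SimpleGraph ℕ) (n ℓ : ℕ) (g : ℕ → ℕ) : Prop where
  mono : Monotone g
  lt : ∀ i < n, g i < ℓ
  surj : ∀ i < ℓ, ∃ x < n, g x = i
  adj : ∀ i j, i < j → j < ℓ → ∃ x < n, ∃ y < n, g x = i ∧ g y = j ∧ G.Adj x y

theorem IsCyclicSeq.isCyclicMinor {V : Type u} {G : SimpleGraph V} {n ℓ : ℕ} {p : ℕ → V}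
    (hp : G.IsCyclicSeq n p) {g : ℕ → ℕ} (hg : (G.comap p).IsCliqueModel n ℓ g) :
    (⊤ : SimpleGraph (Fin ℓ)).IsCyclicMinor G := by
  classical
  have h3 := hp.three_le
  let s : Set V := p '' Set.Iio n
  let S : G.Subgraph := (⊤ : G.Subgraph).induce s
  have hmem : ∀ i, p (i % n) ∈ S.verts := fun i => ⟨i % n, Nat.mod_lt _ (by omega), rfl⟩
  -- Reducing modulo `n` only makes `q` total; the values at `i < n` are the ones that matter.
  let q : ℕ → S.verts := fun i => ⟨p (i % n), hmem i⟩
  have hq : ∀ i < n, (q i : V) = p i := fun i hi => by simp [q, Nat.mod_eq_of_lt hi]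
  have hqinj : ∀ i < n, ∀ j < n, q i = q j → i = j := fun i hi j hj h =>
    hp.inj i hi j hj (by rw [← hq i hi, ← hq j hj, h])
  have hqsurj : ∀ v : S.verts, ∃ i < n, q i = v := by
    rintro ⟨v, i, hi, rfl⟩
    exact ⟨i, hi, Subtype.ext (hq i hi)⟩
  have hqadj : ∀ i < n, ∀ j < n, G.Adj (p i) (p j) → S.coe.Adj (q i) (q j) := by
    intro i hi j hj h
    simp only [Subgraph.coe_adj, S, Subgraph.induce_adj, Subgraph.top_adj]
    refine ⟨(q i).2, (q j).2, ?_⟩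
    rw [hq i hi, hq j hj]
    exact h
  obtain ⟨w, hs, he⟩ := exists_walk_of_forall_adj_succ q (n - 1) fun i hi =>
    hqadj i (by omega) (i + 1) (by omega) (hp.adj i (by omega))
  have hlast : S.coe.Adj (q (n - 1)) (q 0) := hqadj _ (by omega) _ (by omega) hp.close
  have hn1 : n - 1 + 1 = n := by omega
  rw [hn1] at hs
  -- Only path edges inside a fibre of `g` are contracted, never the closing edge, so the components
  -- are exactly the fibres.
  let X : Set (Sym2 S.verts) := {e | ∃ i, i + 1 < n ∧ g i = g (i + 1) ∧ e = s(q i, q (i + 1))}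
  have hnodup : w.support.Nodup := by
    rw [hs]
    refine List.Nodup.map_on ?_ List.nodup_range
    intro i hi j hj h
    exact hqinj i (List.mem_range.1 hi) j (List.mem_range.1 hj) h
  refine ⟨S, q (n - 1), Walk.cons hlast w, X, ?_, ?_, ?_⟩
  · refine Walk.isHamiltonianCycle_cons _ _ hnodup (fun a => ?_) ?_
    · obtain ⟨i, hi, rfl⟩ := hqsurj a
      rw [hs]
      exact List.mem_map.2 ⟨i, List.mem_range.2 hi, rfl⟩
    · rw [he]
      simp only [List.mem_map, List.mem_range, not_exists, not_and]
      intro i hi h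
      rcases Sym2.eq_iff.1 h with ⟨h1, h2⟩ | ⟨h1, h2⟩
      · have := hqinj _ (by omega) _ (by omega) h1
        omega
      · have := hqinj _ (by omega) _ (by omega) h1
        have := hqinj _ (by omega) _ (by omega) h2
        omega
  · rintro e ⟨i, hi, -, rfl⟩
    rw [Walk.edges_cons, he]
    exact List.mem_cons_of_mem _ (List.mem_map.2 ⟨i, List.mem_range.2 (by omega), rfl⟩)
  · choose idx hidx hqidx using hqsurj
    have hidxq : ∀ i < n, idx (q i) = i := fun i hi =>
      hqinj _ (hidx _) _ hi (hqidx _)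
    have hstep : ∀ x y, (fromEdgeSet X).Adj x y → g (idx x) = g (idx y) := by
      intro x y h
      obtain ⟨⟨i, hi, hgi, h⟩, -⟩ := (fromEdgeSet_adj _).1 h
      have h1 := hidxq i (by omega)
      have h2 := hidxq (i + 1) hi
      rcases Sym2.eq_iff.1 h with ⟨rfl, rfl⟩ | ⟨rfl, rfl⟩
      · rw [h1, h2, hgi]
      · rw [h1, h2, hgi]
    have hreach : ∀ x y, (fromEdgeSet X).Reachable x y → g (idx x) = g (idx y) := by
      rintro x y ⟨c⟩
      induction c with
      | nil => rfl
      | cons h _ ih => exact (hstep _ _ h).trans ih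
    have hconn : ∀ d i, i + d < n → g i = g (i + d) →
        (fromEdgeSet X).Reachable (q i) (q (i + d)) := by
      intro d
      induction d with
      | zero => intro i _ _; exact Reachable.refl _
      | succ d ih =>
        intro i hi h
        have h1 : g i ≤ g (i + d) := hg.mono (by omega)
        have h2 : g (i + d) ≤ g (i + (d + 1)) := hg.mono (by omega)
        refine (ih i (by omega) (by omega)).trans (Adj.reachable ?_)
        refine (fromEdgeSet_adj _).2 ⟨⟨i + d, by omega, by rw [add_assoc]; omega, rfl⟩, ?_⟩
        intro h
        have := hqinj _ (by omega) _ hi h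
        omega
    have hconn' : ∀ i < n, ∀ j < n, g i = g j → (fromEdgeSet X).Reachable (q i) (q j) := by
      intro i hi j hj h
      rcases le_total i j with hij | hij
      · obtain ⟨d, rfl⟩ := Nat.exists_eq_add_of_le hij
        exact hconn d i hj h
      · obtain ⟨d, rfl⟩ := Nat.exists_eq_add_of_le hij
        exact (hconn d j hi h.symm).symm
    choose x hx hgx using hg.surj
    let φ : Fin ℓ → (fromEdgeSet X).ConnectedComponent := fun i =>
      (fromEdgeSet X).connectedComponentMk (q (x i i.2))
    have hφ : ∀ k (hk : k < n), φ ⟨g k, hg.lt k hk⟩ = (fromEdgeSet X).connectedComponentMk (q k) :=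
      fun k hk => ConnectedComponent.sound (hconn' _ (hx _ _) _ hk (hgx _ _))
    have hinj : Function.Injective φ := by
      intro i j h
      have := hreach _ _ (ConnectedComponent.exact h)
      rw [hidxq _ (hx _ _), hidxq _ (hx _ _), hgx, hgx] at this
      exact Fin.ext this
    have hsurj : Function.Surjective φ := by
      intro c
      induction c using ConnectedComponent.ind with
      | _ v =>
        refine ⟨⟨g (idx v), hg.lt _ (hidx v)⟩, ?_⟩
        rw [hφ _ (hidx v), hqidx]
    have hlt : ∀ i j : Fin ℓ, i < j → (S.coe.contractEdges X).Adj (φ i) (φ j) := by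
      intro i j hij
      obtain ⟨a, ha, b, hb, hai, hbj, hab⟩ := hg.adj i j hij j.2
      have hi : φ i = (fromEdgeSet X).connectedComponentMk (q a) := by
        rw [← hφ a ha]; congr 1; exact Fin.ext hai.symm
      have hj : φ j = (fromEdgeSet X).connectedComponentMk (q b) := by
        rw [← hφ b hb]; congr 1; exact Fin.ext hbj.symm
      have hne : φ i ≠ φ j := fun h => hij.ne (hinj h)
      rw [hi, hj] at hne ⊢
      exact map_adj_apply' (hqadj a ha b hb hab) hne
    refine ⟨⟨Equiv.ofBijective φ ⟨hinj, hsurj⟩, ?_⟩⟩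
    intro i j
    simp only [top_adj]
    refine ⟨fun h e => h.ne (by rw [e]), fun h => ?_⟩
    rcases lt_or_gt_of_ne h with h | h
    · exact hlt i j h
    · exact (hlt j i h).symm

/-! ### Lower bounds -/

theorem IsCyclicMinor.card_le {V : Type u} [Fintype V] {G : SimpleGraph V} {ℓ : ℕ}
    (h : (⊤ : SimpleGraph (Fin ℓ)).IsCyclicMinor G) : ℓ ≤ Fintype.card V := by
  classical
  obtain ⟨S, a, c, X, -, -, ⟨e⟩⟩ := h
  have : Function.Injective fun i : Fin ℓ => ((e i).out : V) := by
    intro i j hij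
    have h1 : (e i).out = (e j).out := Subtype.ext hij
    rw [← e.injective.eq_iff, ← Quot.out_eq (e i), ← Quot.out_eq (e j)]
    exact congrArg _ h1
  simpa using Fintype.card_le_of_injective _ this

end SimpleGraph

/-- The witness is the complete graph on `ℓ - 1` vertices; `2 ≤ ℓ` makes it nonempty. -/
theorem pred_le_of_mem_cyclicCliqueForcing {ℓ δ : ℕ} (h : δ ∈ cyclicCliqueForcing.{u} ℓ) (hℓ : 2 ≤ ℓ) :
    ℓ - 1 ≤ δ := by
  by_contra hlt
  push Not at hlt
  have : Nonempty (ULift.{u} (Fin (ℓ - 1))) := ⟨⟨⟨0, by omega⟩⟩⟩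
  have := (h (ULift.{u} (Fin (ℓ - 1))) ⊤ (by simp; omega)).card_le
  simp at this
  omega

/-! ### Contracting a dense graph to `K₅` along a Hamiltonian path -/

namespace SimpleGraph

/-- `g` cuts `0, …, n - 1` into `n'` consecutive nonempty intervals. -/
structure IsIntervalMap (n n' : ℕ) (g : ℕ → ℕ) : Prop where
  mono : Monotone g
  lt : ∀ i < n, g i < n'
  surj : ∀ i < n', ∃ x < n, g x = i

/-- The graph obtained from the restriction of `G` to `0, …, n - 1` by identifying the fibres
of `g`. -/
def contractAlong (G : SimpleGraph ℕ) (n : ℕ) (g : ℕ → ℕ) : SimpleGraph ℕ where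
  Adj i j := i ≠ j ∧ ∃ x < n, ∃ y < n, g x = i ∧ g y = j ∧ G.Adj x y
  symm := ⟨fun _ _ ⟨h, x, hx, y, hy, hi, hj, ha⟩ => ⟨h.symm, y, hy, x, hx, hj, hi, ha.symm⟩⟩
  loopless := ⟨fun _ h => h.1 rfl⟩

theorem IsCliqueModel.comp {G : SimpleGraph ℕ} {n n' ℓ : ℕ} {g h : ℕ → ℕ}
    (hh : (G.contractAlong n g).IsCliqueModel n' ℓ h) (hg : IsIntervalMap n n' g) :
    G.IsCliqueModel n ℓ (h ∘ g) where
  mono := hh.mono.comp hg.mono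
  lt i hi := hh.lt _ (hg.lt i hi)
  surj i hi := by
    obtain ⟨y, hy, rfl⟩ := hh.surj i hi
    obtain ⟨x, hx, rfl⟩ := hg.surj y hy
    exact ⟨x, hx, rfl⟩
  adj i j hij hj := by
    obtain ⟨-, -, -, -, rfl, rfl, -, x, hx, y, hy, rfl, rfl, ha⟩ := hh.adj i j hij hj
    exact ⟨x, hx, y, hy, rfl, rfl, ha⟩

theorem IsIntervalMap.contractAlong_adj_succ {G : SimpleGraph ℕ} {n n' : ℕ} {g : ℕ → ℕ}
    (hg : IsIntervalMap n n' g) (hG : ∀ i, i + 1 < n → G.Adj i (i + 1)) :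
    ∀ i, i + 1 < n' → (G.contractAlong n g).Adj i (i + 1) := by
  intro i hi
  classical
  have hex : ∃ x, x < n ∧ g x = i + 1 := hg.surj (i + 1) hi
  obtain ⟨hx, hgx⟩ := Nat.find_spec hex
  obtain ⟨z, hz, hgz⟩ := hg.surj i (by omega)
  set x := Nat.find hex with hxdef
  have hzx : z < x := by
    by_contra hcon
    have := hg.mono (not_lt.1 hcon)
    omega
  have h1 : g z ≤ g (x - 1) := hg.mono (by omega)
  have h2 : g (x - 1) ≤ g x := hg.mono (by omega)
  have h3 : g (x - 1) ≠ i + 1 := fun h => Nat.find_min hex (m := x - 1) (by omega) ⟨by omega, h⟩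
  refine ⟨by omega, x - 1, by omega, x, hx, by omega, hgx, ?_⟩
  have := hG (x - 1) (by omega)
  rwa [Nat.sub_add_cancel (by omega : 1 ≤ x)] at this

open Classical in
/-- The edges of `G` inside `0, …, n - 1`, as increasing pairs. -/
noncomputable def edgePairs (G : SimpleGraph ℕ) (n : ℕ) : Finset (ℕ × ℕ) :=
  {e ∈ Finset.range n ×ˢ Finset.range n | e.1 < e.2 ∧ G.Adj e.1 e.2}

theorem mem_edgePairs {G : SimpleGraph ℕ} {n : ℕ} {i j : ℕ} :
    (i, j) ∈ G.edgePairs n ↔ i < j ∧ j < n ∧ G.Adj i j := by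
  simp only [edgePairs, Finset.mem_filter, Finset.mem_product, Finset.mem_range]
  constructor
  · rintro ⟨⟨_, h2⟩, h3, h4⟩; exact ⟨h3, h2, h4⟩
  · rintro ⟨h1, h2, h3⟩; exact ⟨⟨by omega, h2⟩, h1, h3⟩

/-- Truncated subtraction identifies `0` and `1` and shifts the rest: this contracts the first edge
of the path. -/
theorem isIntervalMap_pred {n : ℕ} (hn : 2 ≤ n) : IsIntervalMap n (n - 1) (· - 1) where
  mono _ _ h := Nat.sub_le_sub_right h 1
  lt i hi := by omega
  surj i hi := ⟨i + 1, by omega, rfl⟩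

open Classical in
-- The contraction loses the edge `01` and one of the two edges `0w`, `1w` for each common neighbour
-- `w`.
theorem card_edgePairs_le_contractAlong_pred (G : SimpleGraph ℕ) {n : ℕ} :
    (G.edgePairs n).card ≤ ((G.contractAlong n (· - 1)).edgePairs (n - 1)).card + 1 +
      {w ∈ Finset.range n | 2 ≤ w ∧ G.Adj 0 w ∧ G.Adj 1 w}.card := by
  set W : Finset ℕ := {w ∈ Finset.range n | 2 ≤ w ∧ G.Adj 0 w ∧ G.Adj 1 w} with hW
  set D : Finset (ℕ × ℕ) := {(0, 1)} ∪ W.image fun w => (0, w) with hD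
  have hDc : D.card ≤ 1 + W.card :=
    (Finset.card_union_le _ _).trans (by
      have := Finset.card_image_le (s := W) (f := fun w => (0, w))
      simpa using this)
  have hmain : (G.edgePairs n \ D).card ≤
      ((G.contractAlong n (· - 1)).edgePairs (n - 1)).card := by
    refine Finset.card_le_card_of_injOn (fun e => (e.1 - 1, e.2 - 1)) ?_ ?_
    · rintro ⟨i, j⟩ h
      simp only [hD, Finset.coe_sdiff, Set.mem_sdiff, Finset.mem_coe, mem_edgePairs, Finset.mem_union,
        Finset.mem_singleton, not_or, Prod.mk.injEq] at h
      obtain ⟨⟨h1, h2, h3⟩, h4, -⟩ := h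
      simp only [Finset.mem_coe, mem_edgePairs]
      refine ⟨by omega, by omega, by omega, i, by omega, j, h2, rfl, rfl, h3⟩
    · have key : ∀ i i' j, (i, j) ∈ G.edgePairs n → (i, j) ∉ D → (i', j) ∈ G.edgePairs n →
          i - 1 = i' - 1 → i < i' → False := by
        intro i i' j h hD' h' he hlt
        rw [mem_edgePairs] at h h'
        have h0 : i = 0 := by omega
        have h1 : i' = 1 := by omega
        subst h0 h1
        refine hD' (Finset.mem_union_right _ (Finset.mem_image_of_mem _ ?_))
        rw [hW, Finset.mem_filter, Finset.mem_range]
        exact ⟨h.2.1, h'.1, h.2.2, h'.2.2⟩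
      rintro ⟨i, j⟩ h ⟨i', j'⟩ h' he
      simp only [Finset.coe_sdiff, Set.mem_sdiff, Finset.mem_coe] at h h'
      simp only [Prod.mk.injEq] at he
      have hj := (mem_edgePairs.1 h.1).1
      have hj' := (mem_edgePairs.1 h'.1).1
      obtain rfl : j = j' := by omega
      rcases lt_trichotomy i i' with hlt | rfl | hlt
      · exact (key i i' j h.1 h.2 h'.1 he.1 hlt).elim
      · rfl
      · exact (key i' i j h'.1 h'.2 h.1 he.1.symm hlt).elim
  have := Finset.card_le_card_sdiff_add_card (s := G.edgePairs n) (t := D)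
  omega

/-- The parts are `{0}`, `{1}` and three intervals containing `a`, `b`, `c`. The first two parts see
everything, consecutive parts are joined by the path, and the chord `pq` over `b` joins the third to
the fifth. -/
theorem isCliqueModel_five_of_crossing {G : SimpleGraph ℕ} {n : ℕ}
    (hG : ∀ i, i + 1 < n → G.Adj i (i + 1)) {a b c p q : ℕ} (ha : 2 ≤ a) (hab : a < b) (hbc : b < c)
    (hc : c < n) (h0a : G.Adj 0 a) (h0b : G.Adj 0 b) (h0c : G.Adj 0 c) (h1a : G.Adj 1 a)
    (h1b : G.Adj 1 b) (h1c : G.Adj 1 c) (hp : 2 ≤ p) (hpb : p < b) (hbq : b < q) (hq : q < n)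
    (hpq : G.Adj p q) : ∃ g, G.IsCliqueModel n 5 g := by
  -- The third interval must reach both `a` and `p` and stop before `b`; dually for the fifth.
  obtain ⟨p', hp'⟩ : ∃ p', p' = max p a := ⟨_, rfl⟩
  obtain ⟨q', hq'⟩ : ∃ q', q' = min q c := ⟨_, rfl⟩
  have e1 : p ≤ p' ∧ a ≤ p' ∧ p' < b := by omega
  have e2 : q' ≤ q ∧ q' ≤ c ∧ b < q' := by omega
  clear hp' hq'
  obtain ⟨g, hg⟩ : ∃ g : ℕ → ℕ, ∀ x, g x = if x = 0 then 0 else if x = 1 then 1 else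
      if x ≤ p' then 2 else if x < q' then 3 else 4 := ⟨_, fun _ => rfl⟩
  have g0 : g 0 = 0 := by simp [hg]
  have g1 : g 1 = 1 := by simp [hg]
  have g2 : ∀ x, 2 ≤ x → x ≤ p' → g x = 2 := by
    intro x h1 h2; rw [hg]; split_ifs <;> omega
  have g3 : ∀ x, p' < x → x < q' → g x = 3 := by
    intro x h1 h2; rw [hg]; split_ifs <;> omega
  have g4 : ∀ x, q' ≤ x → g x = 4 := by
    intro x h1; rw [hg]; split_ifs <;> omega
  refine ⟨g, ?_, ?_, ?_, ?_⟩
  · intro x y hxy; rw [hg, hg]; split_ifs <;> omega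
  · intro x _; rw [hg]; split_ifs <;> omega
  · intro i hi
    interval_cases i
    · exact ⟨0, by omega, g0⟩
    · exact ⟨1, by omega, g1⟩
    · exact ⟨a, by omega, g2 a (by omega) (by omega)⟩
    · exact ⟨b, by omega, g3 b (by omega) (by omega)⟩
    · exact ⟨c, by omega, g4 c (by omega)⟩
  · intro i j hij hj
    have ga := g2 a (by omega) (by omega)
    have gb := g3 b (by omega) (by omega)
    have gc := g4 c (by omega)
    interval_cases j <;> interval_cases i
    · exact ⟨0, by omega, 1, by omega, g0, g1, hG 0 (by omega)⟩
    · exact ⟨0, by omega, a, by omega, g0, ga, h0a⟩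
    · exact ⟨1, by omega, a, by omega, g1, ga, h1a⟩
    · exact ⟨0, by omega, b, by omega, g0, gb, h0b⟩
    · exact ⟨1, by omega, b, by omega, g1, gb, h1b⟩
    · exact ⟨p', by omega, p' + 1, by omega, g2 _ (by omega) (by omega),
        g3 _ (by omega) (by omega), hG p' (by omega)⟩
    · exact ⟨0, by omega, c, by omega, g0, gc, h0c⟩
    · exact ⟨1, by omega, c, by omega, g1, gc, h1c⟩
    · exact ⟨p, by omega, q, by omega, g2 p (by omega) (by omega), g4 q (by omega), hpq⟩
    · refine ⟨q' - 1, by omega, q', by omega, g3 _ (by omega) (by omega), g4 _ (by omega), ?_⟩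
      have := hG (q' - 1) (by omega)
      rwa [Nat.sub_add_cancel (by omega : 1 ≤ q')] at this

theorem isIntervalMap_min {n b : ℕ} (hb : b < n) : IsIntervalMap n (b + 1) (min b) where
  mono _ _ h := by omega
  lt i hi := by omega
  surj i hi := ⟨i, by omega, by omega⟩

/-- The map fixes `0` and `1`, collapses `2, …, b` to `2`, and shifts the later positions. -/
theorem isIntervalMap_cut {n b : ℕ} (hb : 2 ≤ b) (hbn : b < n) :
    IsIntervalMap n (n + 2 - b) (fun x => max (min x 2) (x + 2 - b)) where
  mono _ _ h := by dsimp only; omega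
  lt i hi := by omega
  surj i hi := by
    by_cases h : i < 2
    · exact ⟨i, by omega, by omega⟩
    · exact ⟨i + b - 2, by omega, by omega⟩

open Classical in
/-- If `{0, 1, b}` separates the positions below `b` from those above it, then contracting either
side to `b` and keeping the triangle `0, 1, b` twice preserves the edges. -/
theorem card_edgePairs_add_three_le {G : SimpleGraph ℕ} {n b : ℕ} (hb : 2 ≤ b) (hbn : b < n)
    (h01 : G.Adj 0 1) (h0b : G.Adj 0 b) (h1b : G.Adj 1 b)
    (hsep : ∀ p q, 2 ≤ p → p < b → b < q → q < n → ¬ G.Adj p q) :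
    (G.edgePairs n).card + 3 ≤ ((G.contractAlong n (min b)).edgePairs (b + 1)).card +
      ((G.contractAlong n (fun x => max (min x 2) (x + 2 - b))).edgePairs (n + 2 - b)).card := by
  set E := G.edgePairs n with hE
  set E1 : Finset (ℕ × ℕ) := {e ∈ E | e.2 ≤ b} with hE1
  set E2 : Finset (ℕ × ℕ) := {e ∈ E | (e.1 < 2 ∨ b ≤ e.1) ∧ (e.2 < 2 ∨ b ≤ e.2)} with hE2
  have hunion : E ⊆ E1 ∪ E2 := by
    rintro ⟨i, j⟩ h
    have h' := mem_edgePairs.1 h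
    simp only [hE1, hE2, Finset.mem_union, Finset.mem_filter, h, true_and]
    by_contra hcon
    push Not at hcon
    exact hsep i j (by omega) (by omega) (by omega) h'.2.1 h'.2.2
  have hinter : ({(0, 1), (0, b), (1, b)} : Finset (ℕ × ℕ)) ⊆ E1 ∩ E2 := by
    intro e he
    simp only [Finset.mem_insert, Finset.mem_singleton] at he
    rcases he with rfl | rfl | rfl
    · simp only [hE1, hE2, hE, Finset.mem_inter, Finset.mem_filter, mem_edgePairs]
      exact ⟨⟨⟨by omega, by omega, h01⟩, by omega⟩, ⟨by omega, by omega, h01⟩, by omega⟩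
    · simp only [hE1, hE2, hE, Finset.mem_inter, Finset.mem_filter, mem_edgePairs]
      exact ⟨⟨⟨by omega, by omega, h0b⟩, by omega⟩, ⟨by omega, by omega, h0b⟩, by omega⟩
    · simp only [hE1, hE2, hE, Finset.mem_inter, Finset.mem_filter, mem_edgePairs]
      exact ⟨⟨⟨by omega, by omega, h1b⟩, by omega⟩, ⟨by omega, by omega, h1b⟩, by omega⟩
  have h3 : ({(0, 1), (0, b), (1, b)} : Finset (ℕ × ℕ)).card = 3 := by
    rw [Finset.card_eq_three]
    refine ⟨_, _, _, ?_, ?_, ?_, rfl⟩ <;> simp only [ne_eq, Prod.mk.injEq] <;> omega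
  have hc1 : E1.card ≤ ((G.contractAlong n (min b)).edgePairs (b + 1)).card := by
    refine Finset.card_le_card ?_
    rintro ⟨i, j⟩ h
    simp only [hE1, hE, Finset.mem_filter, mem_edgePairs] at h
    rw [mem_edgePairs]
    exact ⟨h.1.1, by omega, by omega, i, by omega, j, by omega, by omega, by omega, h.1.2.2⟩
  have hc2 : E2.card ≤
      ((G.contractAlong n (fun x => max (min x 2) (x + 2 - b))).edgePairs (n + 2 - b)).card := by
    refine Finset.card_le_card_of_injOn
      (fun e => (max (min e.1 2) (e.1 + 2 - b), max (min e.2 2) (e.2 + 2 - b))) ?_ ?_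
    · rintro ⟨i, j⟩ h
      simp only [hE2, hE, Finset.coe_filter, Set.mem_ofPred_eq, mem_edgePairs] at h
      simp only [Finset.mem_coe, mem_edgePairs]
      exact ⟨by omega, by omega, by omega, i, by omega, j, by omega, rfl, rfl, h.1.2.2⟩
    · rintro ⟨i, j⟩ h ⟨i', j'⟩ h' he
      simp only [hE2, hE, Finset.coe_filter, Set.mem_ofPred_eq, mem_edgePairs] at h h'
      simp only [Prod.mk.injEq] at he ⊢
      omega
  have h4 := Finset.card_le_card hunion
  have h5 := Finset.card_le_card hinter
  have h6 := Finset.card_union_add_card_inter E1 E2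
  omega

open Classical in
/-- A graph with a Hamiltonian path on `n ≥ 3` vertices and at least `3 n - 5` edges can be
contracted along the path to `K₅`. -/
theorem exists_isCliqueModel_five {n : ℕ} (G : SimpleGraph ℕ) (hn : 3 ≤ n)
    (hG : ∀ i, i + 1 < n → G.Adj i (i + 1)) (he : 3 * n ≤ (G.edgePairs n).card + 5) :
    ∃ g, G.IsCliqueModel n 5 g := by
  induction n using Nat.strong_induction_on generalizing G with
  | _ n ih =>
    have step : ∀ n' g, n' < n → 3 ≤ n' → IsIntervalMap n n' g →
        3 * n' ≤ ((G.contractAlong n g).edgePairs n').card + 5 → ∃ g, G.IsCliqueModel n 5 g := by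
      intro n' g h1 h2 hg h3
      obtain ⟨h, hh⟩ := ih n' h1 _ h2 (hg.contractAlong_adj_succ hG) h3
      exact ⟨_, hh.comp hg⟩
    rcases hn.eq_or_lt with rfl | hn4
    -- The base case is vacuous: the bound asks for four edges on three vertices.
    · have hsub : G.edgePairs 3 ⊆ {(0, 1), (0, 2), (1, 2)} := by
        rintro ⟨i, j⟩ h
        rw [mem_edgePairs] at h
        simp only [Finset.mem_insert, Finset.mem_singleton, Prod.mk.injEq]
        omega
      have := (Finset.card_le_card hsub).trans Finset.card_le_three
      omega
    set W : Finset ℕ := {w ∈ Finset.range n | 2 ≤ w ∧ G.Adj 0 w ∧ G.Adj 1 w} with hW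
    -- Here contracting `01` loses at most three edges, which is what `3 n` drops by.
    by_cases hc : W.card ≤ 2
    · refine step (n - 1) _ (by omega) (by omega) (isIntervalMap_pred (by omega)) ?_
      have := G.card_edgePairs_le_contractAlong_pred (n := n)
      rw [← hW] at this
      omega
    · push Not at hc
      obtain ⟨f, hf⟩ : ∃ f : Fin W.card ↪o ℕ, ∀ i, f i ∈ W :=
        ⟨W.orderEmbOfFin rfl, fun i => W.orderEmbOfFin_mem rfl i⟩
      have hf' := fun i => Finset.mem_filter.1 (hf i)
      simp only [Finset.mem_range] at hf'
      have hab : f ⟨0, by omega⟩ < f ⟨1, by omega⟩ := f.strictMono (by simp)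
      have hbc : f ⟨1, by omega⟩ < f ⟨2, by omega⟩ := f.strictMono (by simp)
      have ha := hf' ⟨0, by omega⟩
      have hb := hf' ⟨1, by omega⟩
      have hc := hf' ⟨2, by omega⟩
      revert hab hbc ha hb hc
      generalize f ⟨0, by omega⟩ = a
      generalize f ⟨1, by omega⟩ = b
      generalize f ⟨2, by omega⟩ = c
      rintro hab hbc ⟨ha1, ha2, ha3, ha4⟩ ⟨hb1, hb2, hb3, hb4⟩ ⟨hc1, hc2, hc3, hc4⟩
      by_cases hcross : ∃ p q, 2 ≤ p ∧ p < b ∧ b < q ∧ q < n ∧ G.Adj p q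
      · obtain ⟨p, q, hp, hpb, hbq, hq, hpq⟩ := hcross
        exact isCliqueModel_five_of_crossing hG ha2 hab hbc hc1 ha3 hb3 hc3 ha4 hb4 hc4 hp hpb hbq
          hq hpq
      · have hcount := card_edgePairs_add_three_le hb2 hb1 (hG 0 (by omega)) hb3 hb4
          fun p q hp hpb hbq hq hpq => hcross ⟨p, q, hp, hpb, hbq, hq, hpq⟩
        -- The two sides have `n + 3` vertices and at least three more edges than `G` in total, so
        -- if both missed the bound `G` would have at most `3 n - 6` edges. Both are smaller than
        -- `G` because `2 < b < n - 1`.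
        by_cases h1 : 3 * (b + 1) ≤ ((G.contractAlong n (min b)).edgePairs (b + 1)).card + 5
        · exact step _ _ (by omega) (by omega) (isIntervalMap_min hb1) h1
        · exact step _ _ (by omega) (by omega) (isIntervalMap_cut hb2 hb1) (by omega)

end SimpleGraph

/-! ### Pósa rotations of lists -/

namespace SimpleGraph

variable {V : Type u} {G : SimpleGraph V}

/-- A Pósa rotation: the initial segment before a neighbour `y` of the first vertex `a` is
reversed. -/
inductive Rotation (G : SimpleGraph V) : List V → List V → Prop
  | mk (a : V) (l₁ : List V) (y : V) (l₂ : List V) (h : G.Adj a y) :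
      Rotation G (a :: l₁ ++ y :: l₂) ((a :: l₁).reverse ++ y :: l₂)

/-- The reflexive transitive closure of `Rotation`. -/
def Rotates (G : SimpleGraph V) : List V → List V → Prop := Relation.ReflTransGen G.Rotation

/-- The first vertices of the lists obtained from `l` by rotations. -/
def rotationHeads (G : SimpleGraph V) (l : List V) : Set V := {a | ∃ t, G.Rotates l (a :: t)}

theorem Rotation.append {l l' : List V} (h : G.Rotation l l') (t : List V) :
    G.Rotation (l ++ t) (l' ++ t) := by
  cases h with
  | mk a l₁ y l₂ h =>
    have := Rotation.mk a l₁ y (l₂ ++ t) h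
    simpa using this

theorem Rotates.append {l l' : List V} (h : G.Rotates l l') (t : List V) :
    G.Rotates (l ++ t) (l' ++ t) := by
  induction h with
  | refl => exact .refl
  | tail _ h ih => exact .tail ih (h.append t)

theorem Rotates.perm {l l' : List V} (h : G.Rotates l l') : l.Perm l' := by
  induction h with
  | refl => exact .refl _
  | tail _ h ih =>
    refine ih.trans ?_
    cases h with
    | mk a l₁ y l₂ h => exact ((a :: l₁).reverse_perm.symm.append_right _)

theorem Rotates.isChain {l l' : List V} (h : G.Rotates l l') (hl : l.IsChain G.Adj) :
    l'.IsChain G.Adj := by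
  induction h with
  | refl => exact hl
  | tail _ h ih =>
    cases h with
    | mk a l₁ y l₂ h =>
      rw [List.isChain_append] at ih ⊢
      refine ⟨?_, ih.2.1, ?_⟩
      · rw [List.isChain_reverse]
        exact ih.1.imp fun _ _ h => h.symm
      · intro x hx z hz
        simp at hx hz
        rw [← hx, ← hz]
        exact h

/-- Rotating at a neighbour `y` of the first vertex brings the predecessor `x` of `y` to the front.
-/
theorem mem_rotationHeads_of_adj {l k l₂ : List V} {a x y : V}
    (h : G.Rotates l (k ++ x :: y :: l₂)) (ha : (k ++ [x]).head? = some a) (hy : G.Adj a y) :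
    x ∈ G.rotationHeads l := by
  obtain ⟨l₁, hl₁⟩ : ∃ l₁, k ++ [x] = a :: l₁ := by
    cases k with
    | nil => exact ⟨[], by simpa using ha⟩
    | cons b k => exact ⟨k ++ [x], by simpa using ha⟩
  have h' : G.Rotates l (a :: l₁ ++ y :: l₂) := by
    rw [← hl₁]; simpa using h
  refine ⟨k.reverse ++ y :: l₂, .tail h' ?_⟩
  have := Rotation.mk a l₁ y l₂ hy
  rw [← hl₁] at this ⊢
  simpa using this

/-- A contiguous run of vertices that never become first survives all rotations. -/
theorem Rotates.infix_or_reverse_infix {l l' s : List V} (h : G.Rotates l l') (hs : s <:+: l)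
    (hU : ∀ x ∈ s, x ∉ G.rotationHeads l) : s <:+: l' ∨ s.reverse <:+: l' := by
  have key : ∀ s : List V, (∀ x ∈ s, x ∉ G.rotationHeads l) → ∀ l₁ l₂ : List V, ∀ a y,
      G.Rotates l (a :: l₁ ++ y :: l₂) → G.Adj a y → s <:+: a :: l₁ ++ y :: l₂ →
      s.reverse <:+: (a :: l₁).reverse ++ y :: l₂ ∨ s <:+: (a :: l₁).reverse ++ y :: l₂ := by
    intro s hU l₁ l₂ a y hr hay hs
    rcases List.infix_append_iff.1 hs with hs | hs | ⟨s₁, s₂, rfl, h₁, h₂⟩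
    · exact .inl ((List.reverse_infix.2 hs).trans (List.prefix_append _ _).isInfix)
    · exact .inr (hs.trans (List.suffix_append _ _).isInfix)
    · rcases List.eq_nil_or_concat' s₁ with rfl | ⟨s₁, x, rfl⟩
      · exact .inr (h₂.isInfix.trans (List.suffix_append _ _).isInfix)
      · obtain ⟨k, hk⟩ := h₁
        -- A rotation that splits the run does so just after some `x` in it, and `x` then comes
        -- first.
        refine (hU x (by simp) ?_).elim
        refine mem_rotationHeads_of_adj (k := k ++ s₁) (a := a) (y := y) (l₂ := l₂) ?_ ?_ hay
        · rw [← hk] at hr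
          simpa using hr
        · rw [List.append_assoc, hk]
          rfl
  induction h with
  | refl => exact .inl hs
  | tail h₁ h₂ ih =>
    cases h₂ with
    | mk a l₁ y l₂ hay =>
      rcases ih with ih | ih
      · exact (key s hU _ _ _ _ h₁ hay ih).symm
      · simpa using key s.reverse (by simpa using hU) _ _ _ _ h₁ hay ih

/-- When `a` is first, the run is still contiguous, up to reversal. A neighbour of `a` in it must be
its first element, since otherwise its predecessor, a member of the run, could be brought to the
front. -/
theorem eq_of_adj_of_mem_run {l s : List V} (hs : s <:+: l)
    (hU : ∀ x ∈ s, x ∉ G.rotationHeads l) {a y z : V} (ha : a ∈ G.rotationHeads l) (hy : y ∈ s)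
    (hz : z ∈ s) (hay : G.Adj a y) (haz : G.Adj a z) : y = z := by
  obtain ⟨t, ht⟩ := ha
  obtain ⟨s', hs', hmem⟩ : ∃ s', s' <:+: a :: t ∧ ∀ x, x ∈ s' ↔ x ∈ s := by
    rcases ht.infix_or_reverse_infix hs hU with h | h
    · exact ⟨_, h, fun _ => Iff.rfl⟩
    · exact ⟨_, h, fun _ => List.mem_reverse⟩
  have key : ∀ z, z ∈ s' → G.Adj a z → s'.head? = some z := by
    intro z hz haz
    obtain ⟨s₁, s₂, rfl⟩ := List.append_of_mem hz
    rcases List.eq_nil_or_concat' s₁ with rfl | ⟨s₁, x, rfl⟩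
    · rfl
    · obtain ⟨c, d, hcd⟩ := hs'
      refine (hU x ((hmem x).1 (by simp)) ?_).elim
      refine mem_rotationHeads_of_adj (k := c ++ s₁) (a := a) (y := z) (l₂ := s₂ ++ d) ?_ ?_ haz
      · rw [← hcd] at ht
        simpa using ht
      · have : ((c ++ s₁) ++ [x]) ++ (z :: s₂ ++ d) = a :: t := by rw [← hcd]; simp
        have h2 := congrArg List.head? this
        rwa [List.head?_append_of_ne_nil _ (by simp)] at h2
  have h1 := key y ((hmem y).2 hy) hay
  have h2 := key z ((hmem z).2 hz) haz
  exact Option.some.inj (h1.symm.trans h2)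

/-- If `a` and `b` were adjacent, the whole block from `a` to `b` would survive every rotation up to
reversal. Once `a` is first, rotating at `b` would bring the last element of `s` to the front. -/
theorem not_adj_of_run {l s : List V} (hl : l.Nodup) {a b : V} (hs : a :: s ++ [b] <:+: l)
    (hs0 : s ≠ []) (hU : ∀ x ∈ s, x ∉ G.rotationHeads l) (ha : a ∈ G.rotationHeads l) :
    ¬ G.Adj a b := by
  intro hab
  have hend : ∀ (a b : V) (s t : List V), s ≠ [] → (∀ x ∈ s, x ∉ G.rotationHeads l) →
      G.Adj a b → ¬ G.Rotates l (a :: s ++ b :: t) := by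
    intro a b s t hs0 hU hab hr
    rcases List.eq_nil_or_concat' s with rfl | ⟨s, x, rfl⟩
    · exact hs0 rfl
    · exact hU x (by simp) (mem_rotationHeads_of_adj (k := a :: s) (a := a) (y := b) (l₂ := t)
        (by simpa using hr) rfl hab)
  have key : ∀ (a b : V) (s : List V), s ≠ [] → (∀ x ∈ s, x ∉ G.rotationHeads l) → G.Adj a b →
      ∀ l₁ l₂ : List V, ∀ c y, G.Rotates l (c :: l₁ ++ y :: l₂) → G.Adj c y →
      a :: s ++ [b] <:+: c :: l₁ ++ y :: l₂ →
      (a :: s ++ [b]).reverse <:+: (c :: l₁).reverse ++ y :: l₂ ∨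
        a :: s ++ [b] <:+: (c :: l₁).reverse ++ y :: l₂ := by
    intro a b s hs0 hU hab l₁ l₂ c y hr hcy hs
    rcases List.infix_append_iff.1 hs with hs | hs | ⟨s₁, s₂, he, h₁, h₂⟩
    · exact .inl ((List.reverse_infix.2 hs).trans (List.prefix_append _ _).isInfix)
    · exact .inr (hs.trans (List.suffix_append _ _).isInfix)
    · rcases List.eq_nil_or_concat' s₁ with rfl | ⟨s₁, x, rfl⟩
      · rw [he]
        exact .inr (h₂.isInfix.trans (List.suffix_append _ _).isInfix)
      rcases List.eq_nil_or_concat' s₂ with rfl | ⟨s₂, x', rfl⟩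
      · rw [he]
        refine .inl ((List.reverse_infix.2 ?_).trans (List.prefix_append _ _).isInfix)
        simpa using h₁.isInfix
      exfalso
      rw [← List.append_assoc] at he
      have he' := (List.append_inj' he rfl).1
      have hb : b = x' := by simpa using (List.append_inj' he rfl).2
      subst hb
      obtain ⟨k, hk⟩ := h₁
      have hx : x ∈ G.rotationHeads l := by
        refine mem_rotationHeads_of_adj (k := k ++ s₁) (a := c) (y := y) (l₂ := l₂) ?_ ?_ hcy
        · rw [← hk] at hr
          simpa using hr
        · rw [List.append_assoc, hk]
          rfl
      cases s₁ with
      | cons e s₁ =>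
        refine hU x ?_ hx
        have : s = s₁ ++ [x] ++ s₂ := by simpa using (List.cons.inj he').2
        rw [this]; simp
      | nil =>
        -- The only possible split is between `a` and `s`. It puts `a` first with `s` and `b` still
        -- in order ahead, so rotating at `b` exposes the last element of `s`.
        obtain ⟨rfl, rfl⟩ : a = x ∧ s = s₂ := by simpa using he'
        obtain ⟨d, hd⟩ := h₂
        have hr' : G.Rotates l (a :: k.reverse ++ s ++ b :: d) := by
          refine hr.tail ?_
          have := Rotation.mk c l₁ y l₂ hcy
          rw [← hk, ← hd] at this ⊢
          simpa using this
        rcases List.eq_nil_or_concat' s with rfl | ⟨s, x, rfl⟩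
        · exact hs0 rfl
        · exact hU x (by simp) (mem_rotationHeads_of_adj (k := a :: k.reverse ++ s) (a := a) (y := b)
            (l₂ := d) (by simpa using hr') rfl hab)
  have hall : ∀ l', G.Rotates l l' → a :: s ++ [b] <:+: l' ∨ (a :: s ++ [b]).reverse <:+: l' := by
    intro l' h
    induction h with
    | refl => exact .inl hs
    | tail h₁ h₂ ih =>
      cases h₂ with
      | mk c l₁ y l₂ hcy =>
        rcases ih with ih | ih
        · exact (key a b s hs0 hU hab _ _ _ _ h₁ hcy ih).symm
        · have := key b a s.reverse (by simpa using hs0) (by simpa using hU) hab.symm l₁ l₂ c y h₁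
            hcy (by simpa using ih)
          simpa using this
  obtain ⟨t, ht⟩ := ha
  have hnd : (a :: t).Nodup := ht.perm.nodup_iff.1 hl
  rcases hall _ ht with ⟨c, d, hcd⟩ | ⟨c, d, hcd⟩
  · cases c with
    | nil =>
      refine hend a b s d hs0 hU hab ?_
      rw [← hcd] at ht
      simpa using ht
    | cons e c =>
      simp only [List.cons_append, List.cons.injEq] at hcd
      refine (List.nodup_cons.1 hnd).1 ?_
      rw [← hcd.2]; simp
  · have hab' := hab.ne'
    cases c with
    | nil =>
      simp at hcd
      exact hab' hcd.1
    | cons e c =>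
      simp only [List.cons_append, List.cons.injEq] at hcd
      refine (List.nodup_cons.1 hnd).1 ?_
      rw [← hcd.2]; simp

end SimpleGraph

/-! ### Rotation systems from longest paths -/

namespace SimpleGraph

variable {V : Type u} {G : SimpleGraph V}

/-- A cycle on `p 0, …, p (n - 1)` together with the positions `U` of the vertices that become
first under rotations, all of whose neighbours lie on the cycle. -/
structure IsRotationSystem (G : SimpleGraph V) (n : ℕ) (p : ℕ → V) (U : ℕ → Prop) : Prop where
  pos : 0 < n
  inj : ∀ i < n, ∀ j < n, p i = p j → i = j
  adj : ∀ i, i + 1 < n → G.Adj (p i) (p (i + 1))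
  close : G.Adj (p (n - 1)) (p 0)
  zero : U 0
  closed : ∀ i < n, U i → ∀ y, G.Adj (p i) y → ∃ j < n, p j = y
  pred : ∀ i, i + 1 < n → G.Adj (p 0) (p (i + 1)) → U i
  run : ∀ i j, i ≤ j → j < n → (∀ k, i ≤ k → k ≤ j → ¬ U k) → ∀ m < n, U m →
    G.Adj (p m) (p i) → G.Adj (p m) (p j) → i = j
  not_adj : ∀ i j, i + 1 < j → j < n → U i → (∀ k, i < k → k < j → ¬ U k) →
    ¬ G.Adj (p i) (p j)

/-- A longest path splits as `l ++ t` with `l` closed under taking neighbours of rotated first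
vertices. -/
theorem exists_rotation_closed_list [Finite V] [Nonempty V] (hG : ∀ v, ∃ w, G.Adj v w) :
    ∃ (a : V) (l : List V) (hl : l ≠ []), (a :: l).Nodup ∧ (a :: l).IsChain G.Adj ∧
      G.Adj a (l.getLast hl) ∧ ∀ b t, G.Rotates (a :: l) (b :: t) → ∀ y, G.Adj b y → y ∈ b :: t := by
  have := Fintype.ofFinite V
  set N := Fintype.card V with hN
  -- The closing chord is not required of a one-vertex segment, so good pairs exist.
  let good : List V → List V → Prop := fun l t => (l ++ t).Nodup ∧ (l ++ t).IsChain G.Adj ∧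
    ∃ (a : V) (m : List V), l = a :: m ∧ ∀ h : m ≠ [], G.Adj a (m.getLast h)
  -- The weight `N + 1` makes the order lexicographic: the length of the path first, then that of
  -- its closed segment.
  let K : Set ℕ := {k | ∃ l t, good l t ∧ k = (l ++ t).length * (N + 1) + l.length}
  have hlen : ∀ l t, good l t → (l ++ t).length ≤ N := fun l t h => h.1.length_le_card
  have hbdd : BddAbove K := by
    refine ⟨N * (N + 1) + N, ?_⟩
    rintro k ⟨l, t, h, rfl⟩
    have h1 := hlen l t h
    have h2 : l.length ≤ (l ++ t).length := by simp
    exact Nat.add_le_add (Nat.mul_le_mul_right _ h1) (h2.trans h1)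
  have hne : K.Nonempty := by
    obtain ⟨v⟩ := ‹Nonempty V›
    exact ⟨_, [v], [], ⟨by simp, by simp, v, [], rfl, fun h => (h rfl).elim⟩, rfl⟩
  obtain ⟨l, t, hlt, hk⟩ := Nat.sSup_mem hne hbdd
  have hmax : ∀ l' t', good l' t' → (l' ++ t').length * (N + 1) + l'.length ≤
      (l ++ t).length * (N + 1) + l.length := by
    intro l' t' h
    rw [← hk]
    exact le_csSup hbdd ⟨l', t', h, rfl⟩
  obtain ⟨hnd, hch, a, m, rfl, hclose⟩ := hlt
  have hclosed : ∀ b s, G.Rotates (a :: m) (b :: s) → ∀ y, G.Adj b y → y ∈ b :: s := by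
    intro b s hr y hy
    by_contra hys
    have hr' := hr.append t
    have hnd' := hr'.perm.nodup_iff.1 hnd
    have hch' := hr'.isChain hch
    have hlen1 := hr.perm.length_eq
    have hlen2 := hr'.perm.length_eq
    -- A neighbour in `t` closes a longer segment of the same path; one off the path lengthens the
    -- path.
    by_cases hyt : y ∈ t
    · obtain ⟨t₁, t₂, rfl⟩ := List.append_of_mem hyt
      have hg : good (b :: s ++ t₁ ++ [y]) t₂ := by
        refine ⟨by simpa using hnd', by simpa using hch', b, s ++ t₁ ++ [y], by simp, ?_⟩
        intro h
        simpa using hy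
      have := hmax _ _ hg
      have h1 : (b :: s ++ t₁ ++ [y] ++ t₂).length = (a :: m ++ y :: t₂).length + t₁.length := by
        simp at hlen1 ⊢; omega
      have h2 : (a :: m ++ (t₁ ++ y :: t₂)).length = (a :: m ++ y :: t₂).length + t₁.length := by
        simp; omega
      have h3 : (b :: s ++ t₁ ++ [y]).length = (a :: m).length + t₁.length + 1 := by
        simp at hlen1 ⊢; omega
      rw [h1, h2, h3] at this
      omega
    · have hg : good [y] (b :: s ++ t) := by
        refine ⟨?_, ?_, y, [], rfl, fun h => (h rfl).elim⟩
        · rw [List.singleton_append, List.nodup_cons]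
          exact ⟨fun h => (List.mem_append.1 h).elim hys hyt, hnd'⟩
        · simpa using ⟨hy.symm, by simpa using hch'⟩
      have := hmax _ _ hg
      have h1 : ([y] ++ (b :: s ++ t)).length = (a :: m ++ t).length + 1 := by
        rw [hlen2]; simp
      have h2 := hlen _ _ ⟨hnd, hch, a, m, rfl, hclose⟩
      have h3 : (a :: m).length ≤ (a :: m ++ t).length := by simp
      rw [h1, Nat.add_mul] at this
      simp only [List.length_singleton] at this
      omega
  have hm : m ≠ [] := by
    rintro rfl
    obtain ⟨w, hw⟩ := hG a
    have := hclosed a [] .refl w hw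
    rw [List.mem_singleton] at this
    exact hw.ne' this
  refine ⟨a, m, hm, ?_, ?_, hclose hm, hclosed⟩
  · exact (List.nodup_append.1 hnd).1
  · exact (List.isChain_append.1 hch).1

theorem exists_isRotationSystem [Finite V] [Nonempty V] (hG : ∀ v, ∃ w, G.Adj v w) :
    ∃ n p U, G.IsRotationSystem n p U := by
  obtain ⟨a, m, hm, hnd, hch, hclose, hclosed⟩ := exists_rotation_closed_list hG
  obtain ⟨l, hl⟩ : ∃ l, l = a :: m := ⟨_, rfl⟩
  let p : ℕ → V := fun i => l.getD i a
  have hp : ∀ i (h : i < l.length), p i = l[i] := fun i h => List.getD_eq_getElem _ _ h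
  have hp0 : p 0 = a := by simp [p, hl]
  have hlen : l.length = m.length + 1 := by simp [hl]
  have hmpos : 0 < m.length := List.length_pos_iff.2 hm
  have hmem : ∀ y ∈ l, ∃ j < l.length, p j = y := by
    intro y hy
    obtain ⟨j, hj, rfl⟩ := List.mem_iff_getElem.1 hy
    exact ⟨j, hj, hp j hj⟩
  rw [← hl] at hnd hch
  have hrun : ∀ i j, (∀ k, i ≤ k → k < j → ¬ p k ∈ G.rotationHeads l) → j ≤ l.length →
      ∀ x ∈ (l.drop i).take (j - i), x ∉ G.rotationHeads l := by
    intro i j h hj x hx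
    obtain ⟨k, hk, rfl⟩ := List.mem_iff_getElem.1 hx
    simp only [List.length_take, List.length_drop, lt_inf_iff] at hk
    rw [List.getElem_take, List.getElem_drop, ← hp]
    exact h _ (by omega) (by omega)
  have hinfix : ∀ i j, (l.drop i).take j <:+: l := fun i j =>
    (List.take_prefix _ _).isInfix.trans (List.drop_suffix _ _).isInfix
  have hmemtake : ∀ i j k, i ≤ k → k < j → j ≤ l.length → p k ∈ (l.drop i).take (j - i) := by
    intro i j k hik hkj hj
    rw [hp k (by omega)]
    refine List.mem_iff_getElem.2 ⟨k - i, by simp; omega, ?_⟩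
    rw [List.getElem_take, List.getElem_drop]
    congr 1
    omega
  refine ⟨l.length, p, fun i => p i ∈ G.rotationHeads l, ?_, ?_, ?_, ?_, ?_, ?_, ?_, ?_, ?_⟩
  · omega
  · intro i hi j hj h
    rw [hp i hi, hp j hj] at h
    exact (hnd.getElem_inj_iff).1 h
  · intro i hi
    rw [hp i (by omega), hp _ hi]
    exact List.isChain_iff_getElem.1 hch i hi
  · rw [hp0, hp _ (by omega)]
    have : l[l.length - 1]'(by omega) = m.getLast hm := by
      subst hl
      rw [List.getLast_eq_getElem]
      simp only [List.length_cons, Nat.add_sub_cancel]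
      rw [List.getElem_cons]
      rw [dif_neg (by omega)]
    rw [this]
    exact hclose.symm
  · exact ⟨m, by rw [hp0, ← hl]; exact .refl⟩
  · rintro i hi ⟨t, ht⟩ y hy
    rw [hl] at ht
    refine hmem y ?_
    rw [hl]
    exact ht.perm.mem_iff.2 (hclosed _ _ ht y hy)
  · intro i hi hadj
    have hsplit : l = l.take i ++ p i :: p (i + 1) :: l.drop (i + 2) := by
      rw [hp i (by omega), hp _ hi, ← List.drop_eq_getElem_cons, ← List.drop_eq_getElem_cons,
        List.take_append_drop]
    refine mem_rotationHeads_of_adj (k := l.take i) (a := p 0) (y := p (i + 1))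
      (l₂ := l.drop (i + 2)) ?_ ?_ hadj
    · rw [← hsplit]
      exact .refl
    · have h2 := congrArg List.head? hsplit
      have h3 : l.take i ++ p i :: p (i + 1) :: l.drop (i + 2) =
        (l.take i ++ [p i]) ++ p (i + 1) :: l.drop (i + 2) := by simp
      rw [h3, List.head?_append_of_ne_nil _ (by simp)] at h2
      rw [← h2, hp0, hl]
      rfl
  · intro i j hij hj hU k hk hkU hi hj'
    have := eq_of_adj_of_mem_run (hinfix i (j + 1 - i))
      (hrun i (j + 1) (fun k h1 h2 => hU k h1 (by omega)) (by omega)) hkU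
      (hmemtake i (j + 1) i (by omega) (by omega) (by omega))
      (hmemtake i (j + 1) j (by omega) (by omega) (by omega)) hi hj'
    rw [hp i (by omega), hp j hj] at this
    exact (hnd.getElem_inj_iff).1 this
  · intro i j hij hj hi hU
    have heq : p i :: (l.drop (i + 1)).take (j - (i + 1)) ++ [p j] = (l.drop i).take (j + 1 - i) := by
      rw [List.drop_eq_getElem_cons (by omega : i < l.length), hp i (by omega), hp j hj]
      obtain ⟨d, rfl⟩ : ∃ d, j = i + 1 + d := ⟨j - (i + 1), by omega⟩
      have h1 : i + 1 + d - (i + 1) = d := by omega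
      have h2 : i + 1 + d + 1 - i = d + 1 + 1 := by omega
      rw [h1, h2, List.take_succ_cons, List.take_succ_eq_append_getElem (by simp; omega)]
      simp
    refine not_adj_of_run hnd (s := (l.drop (i + 1)).take (j - (i + 1))) ?_ ?_ ?_ hi
    · rw [heq]
      exact hinfix _ _
    · intro h
      have := congrArg List.length h
      simp at this
      omega
    · exact hrun (i + 1) j (fun k h1 h2 => hU k (by omega) h2) (by omega)

end SimpleGraph

/-! ### The cases `K₃` and `K₄` -/

namespace SimpleGraph

variable {V : Type u} {G : SimpleGraph V}

open Classical in
theorem degree_le_card_filter [Fintype V] [DecidableRel G.Adj] {n : ℕ} {p : ℕ → V} {v : V}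
    (h : ∀ y, G.Adj v y → ∃ j < n, p j = y) :
    G.degree v ≤ {j ∈ Finset.range n | G.Adj v (p j)}.card := by
  rw [← card_neighborFinset_eq_degree]
  refine (Finset.card_le_card (t := Finset.image p {j ∈ Finset.range n | G.Adj v (p j)}) ?_).trans
    Finset.card_image_le
  intro y hy
  rw [mem_neighborFinset] at hy
  obtain ⟨j, hj, rfl⟩ := h y hy
  exact Finset.mem_image_of_mem _ (Finset.mem_filter.2 ⟨Finset.mem_range.2 hj, hy⟩)

/-- Two crossing chords of a cycle give `K₄` as a cyclic minor. -/
theorem IsCyclicSeq.isCyclicMinor_four {n a b : ℕ} {p : ℕ → V} (hp : G.IsCyclicSeq n p)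
    (ha : 0 < a) (hab : a + 1 < b) (hb : b < n) (h₁ : G.Adj (p 0) (p (a + 1)))
    (h₂ : G.Adj (p a) (p b)) : (⊤ : SimpleGraph (Fin 4)).IsCyclicMinor G := by
  -- The parts are `[0, a)`, `{a}`, `(a, b)` and `[b, n)`; the closing edge joins the first to the
  -- last.
  obtain ⟨g, hg⟩ : ∃ g : ℕ → ℕ, ∀ x, g x = if x < a then 0 else if x < a + 1 then 1 else
      if x < b then 2 else 3 := ⟨_, fun _ => rfl⟩
  have g0 : ∀ x, x < a → g x = 0 := by intro x h; rw [hg]; split_ifs; omega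
  have g1 : g a = 1 := by rw [hg]; split_ifs <;> omega
  have g2 : ∀ x, a < x → x < b → g x = 2 := by intro x h h'; rw [hg]; split_ifs <;> omega
  have g3 : ∀ x, b ≤ x → g x = 3 := by intro x h; rw [hg]; split_ifs <;> omega
  refine hp.isCyclicMinor (ℓ := 4) (g := g) ⟨?_, ?_, ?_, ?_⟩
  · intro x y hxy; rw [hg, hg]; split_ifs <;> omega
  · intro x _; rw [hg]; split_ifs <;> omega
  · intro i hi
    interval_cases i
    · exact ⟨0, by omega, g0 0 ha⟩
    · exact ⟨a, by omega, g1⟩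
    · exact ⟨a + 1, by omega, g2 _ (by omega) hab⟩
    · exact ⟨b, by omega, g3 _ le_rfl⟩
  · intro i j hij hj
    have hpred : ∀ k, 0 < k → k < n → (G.comap p).Adj (k - 1) k := by
      intro k hk hkn
      have := hp.adj (k - 1) (by omega)
      rwa [Nat.sub_add_cancel hk] at this
    interval_cases j <;> interval_cases i
    · exact ⟨a - 1, by omega, a, by omega, g0 _ (by omega), g1, hpred a ha (by omega)⟩
    · exact ⟨0, by omega, a + 1, by omega, g0 _ ha, g2 _ (by omega) hab, h₁⟩
    · exact ⟨a, by omega, a + 1, by omega, g1, g2 _ (by omega) hab, hp.adj a (by omega)⟩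
    · exact ⟨0, by omega, n - 1, by omega, g0 _ ha, g3 _ (by omega), hp.close.symm⟩
    · exact ⟨a, by omega, b, by omega, g1, g3 _ le_rfl, h₂⟩
    · exact ⟨b - 1, by omega, b, by omega, g2 _ (by omega) (by omega), g3 _ le_rfl,
        hpred b (by omega) hb⟩

theorem IsCyclicSeq.isCyclicMinor_three {n : ℕ} {p : ℕ → V} (hp : G.IsCyclicSeq n p) :
    (⊤ : SimpleGraph (Fin 3)).IsCyclicMinor G := by
  have h3 := hp.three_le
  refine hp.isCyclicMinor (ℓ := 3) (g := fun i => min i 2) ⟨?_, ?_, ?_, ?_⟩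
  · intro x y hxy; dsimp only; omega
  · intro x _; omega
  · intro i hi; exact ⟨i, by omega, by omega⟩
  · intro i j hij hj
    interval_cases j <;> interval_cases i
    · exact ⟨0, by omega, 1, by omega, rfl, rfl, hp.adj 0 (by omega)⟩
    · exact ⟨0, by omega, n - 1, by omega, rfl, by omega, hp.close.symm⟩
    · exact ⟨1, by omega, 2, by omega, rfl, rfl, hp.adj 1 (by omega)⟩

theorem isCyclicMinor_three_of_two_le_degree [Fintype V] [Nonempty V] [DecidableRel G.Adj]
    (hG : ∀ v, 2 ≤ G.degree v) : (⊤ : SimpleGraph (Fin 3)).IsCyclicMinor G := by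
  classical
  obtain ⟨n, p, U, hR⟩ := exists_isRotationSystem (G := G) fun v =>
    (G.degree_pos_iff_exists_adj v).1 (by have := hG v; omega)
  refine IsCyclicSeq.isCyclicMinor_three (n := n) (p := p) ⟨?_, hR.inj, hR.adj, hR.close⟩
  have h1 := (hG (p 0)).trans (degree_le_card_filter (hR.closed 0 hR.pos hR.zero))
  have h2 : {j ∈ Finset.range n | G.Adj (p 0) (p j)} ⊆ (Finset.range n).erase 0 := by
    intro j hj
    rw [Finset.mem_filter] at hj
    refine Finset.mem_erase.2 ⟨?_, hj.1⟩
    rintro rfl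
    exact hj.2.ne rfl
  have h3 := Finset.card_le_card h2
  rw [Finset.card_erase_of_mem (Finset.mem_range.2 hR.pos), Finset.card_range] at h3
  omega

theorem isCyclicMinor_four_of_three_le_degree [Fintype V] [Nonempty V] [DecidableRel G.Adj]
    (hG : ∀ v, 3 ≤ G.degree v) : (⊤ : SimpleGraph (Fin 4)).IsCyclicMinor G := by
  classical
  let IsPathSeq : ℕ → (ℕ → V) → Prop := fun n p =>
    (∀ i < n, ∀ j < n, p i = p j → i = j) ∧ ∀ i, i + 1 < n → G.Adj (p i) (p (i + 1))
  have hbdd : BddAbove {n | ∃ p, IsPathSeq n p} := by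
    refine ⟨Fintype.card V, ?_⟩
    rintro n ⟨p, hp, -⟩
    have := Fintype.card_le_of_injective (fun i : Fin n => p i)
      fun i j h => Fin.ext (hp i i.2 j j.2 h)
    simpa using this
  obtain ⟨v⟩ := ‹Nonempty V›
  have h1 : 1 ∈ {n | ∃ p, IsPathSeq n p} := ⟨fun _ => v, by intro i hi j hj _; omega, by
    intro i hi; omega⟩
  obtain ⟨p₀, hp₀⟩ := Nat.sSup_mem ⟨1, h1⟩ hbdd
  have hN0 := le_csSup hbdd h1
  have hmax : ∀ n, (∃ p, IsPathSeq n p) → n ≤ sSup {n | ∃ p, IsPathSeq n p} :=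
    fun n hn => le_csSup hbdd hn
  generalize sSup {n | ∃ p, IsPathSeq n p} = N at *
  have hclosed : ∀ p, IsPathSeq N p → ∀ y, G.Adj (p 0) y → ∃ j < N, p j = y := by
    intro p hp y hy
    by_contra hcon
    push Not at hcon
    have := hmax (N + 1) ⟨fun i => if i = 0 then y else p (i - 1), ?_, ?_⟩
    · omega
    · intro i hi j hj h
      dsimp only at h
      split_ifs at h with h1 h2 h2
      · omega
      · exact (hcon _ (by omega) h.symm).elim
      · exact (hcon _ (by omega) h).elim
      · have := hp.1 _ (by omega) _ (by omega) h
        omega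
    · intro i hi
      rcases Nat.eq_zero_or_pos i with rfl | h
      · simpa using hy.symm
      · have := hp.2 (i - 1) (by omega)
        rw [Nat.sub_add_cancel h] at this
        simpa [h.ne'] using this
  have hfar : ∀ p, IsPathSeq N p → ∃ b < N, G.Adj (p 0) (p b) ∧
      ∀ j < N, b < j → ¬ G.Adj (p 0) (p j) := by
    intro p hp
    have h3 := (hG (p 0)).trans (degree_le_card_filter (hclosed p hp))
    obtain ⟨b, hb, hbmax⟩ := Finset.exists_max_image
      {j ∈ Finset.range N | G.Adj (p 0) (p j)} id (Finset.card_pos.1 (by omega))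
    rw [Finset.mem_filter, Finset.mem_range] at hb
    refine ⟨b, hb.1, hb.2, fun j hj hbj hadj => ?_⟩
    have := hbmax j (Finset.mem_filter.2 ⟨Finset.mem_range.2 hj, hadj⟩)
    simp only [id_eq] at this
    omega
  -- Among all longest paths, the farthest neighbour `b` of the first vertex is taken as near as
  -- possible.
  have hex : ∃ b, ∃ p, IsPathSeq N p ∧ b < N ∧ G.Adj (p 0) (p b) ∧
      ∀ j < N, b < j → ¬ G.Adj (p 0) (p j) := by
    obtain ⟨b, hb⟩ := hfar p₀ hp₀
    exact ⟨b, p₀, hp₀, hb⟩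
  obtain ⟨p, hp, hbN, hb, hbfar⟩ := Nat.find_spec hex
  have hbmin : ∀ b', (∃ p, IsPathSeq N p ∧ b' < N ∧ G.Adj (p 0) (p b') ∧
      ∀ j < N, b' < j → ¬ G.Adj (p 0) (p j)) → Nat.find hex ≤ b' := fun b' h => Nat.find_min' hex h
  generalize Nat.find hex = b at *
  -- Of three neighbours, one is neither the next vertex nor the farthest one.
  obtain ⟨a, ha, hab, hadj⟩ : ∃ a, 0 < a ∧ a + 1 < b ∧ G.Adj (p 0) (p (a + 1)) := by
    by_contra hcon
    push Not at hcon
    have hsub : {j ∈ Finset.range N | G.Adj (p 0) (p j)} ⊆ {1, b} := by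
      intro j hj
      rw [Finset.mem_filter, Finset.mem_range] at hj
      have h0 : j ≠ 0 := by rintro rfl; exact hj.2.ne rfl
      have h1 : ¬ b < j := fun h => hbfar j hj.1 h hj.2
      rw [Finset.mem_insert, Finset.mem_singleton]
      by_contra hne
      have := hcon (j - 1) (by omega) (by omega)
      rw [Nat.sub_add_cancel (by omega)] at this
      exact this hj.2
    have h3 := (hG (p 0)).trans (degree_le_card_filter (hclosed p hp))
    have := (Finset.card_le_card hsub).trans Finset.card_le_two
    omega
  obtain ⟨q, hq⟩ : ∃ q : ℕ → V, ∀ i, q i = if i ≤ a then p (a - i) else p i :=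
    ⟨_, fun _ => rfl⟩
  have hq1 : ∀ i, i ≤ a → q i = p (a - i) := fun i h => by rw [hq, if_pos h]
  have hq2 : ∀ i, a < i → q i = p i := fun i h => by rw [hq, if_neg (by omega)]
  have hqp : IsPathSeq N q := by
    constructor
    · intro i hi j hj h
      rw [hq, hq] at h
      split_ifs at h
      all_goals
        have := hp.1 _ (by omega) _ (by omega) h
        omega
    · intro i hi
      rcases lt_trichotomy i a with h | rfl | h
      · rw [hq1 i h.le, hq1 _ h]
        have := hp.2 (a - (i + 1)) (by omega)
        rw [show a - (i + 1) + 1 = a - i by omega] at this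
        exact this.symm
      · rw [hq1 i le_rfl, hq2 _ (by omega), Nat.sub_self]
        exact hadj
      · rw [hq2 i h, hq2 _ (by omega)]
        exact hp.2 i hi
  -- Minimality of `b` gives `b ≤ c`, so the cycle closed by the chord from `q 0` to `q c` contains
  -- the crossing chords from `0` to `a + 1` and from `a` to `b`.
  obtain ⟨c, hcN, hc, hcfar⟩ := hfar q hqp
  have hbc := hbmin c ⟨q, hqp, hcN, hc, hcfar⟩
  refine IsCyclicSeq.isCyclicMinor_four (n := c + 1) (a := a) (b := b) (p := q)
    ⟨by omega, ?_, ?_, ?_⟩ ha hab (by omega) ?_ ?_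
  · exact fun i hi j hj h => hqp.1 i (by omega) j (by omega) h
  · exact fun i hi => hqp.2 i (by omega)
  · simpa using hc.symm
  · rw [hq1 0 (by omega), hq2 _ (by omega), Nat.sub_zero]
    exact hp.2 a (by omega)
  · rw [hq1 a le_rfl, hq2 b (by omega), Nat.sub_self]
    exact hb

end SimpleGraph

/-! ### Edge counts for two contractions, and `K₅` -/

namespace SimpleGraph

/-- `Nat.count P` cuts the path between `k` and `k + 1` exactly when `P k` holds. -/
theorem isIntervalMap_count (P : ℕ → Prop) [DecidablePred P] {n : ℕ} (hn : 0 < n) :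
    IsIntervalMap n (Nat.count P (n - 1) + 1) (Nat.count P) where
  mono := Nat.count_monotone P
  lt i hi := Nat.lt_succ_of_le (Nat.count_monotone P (by omega))
  surj := by
    have key : ∀ N i, i ≤ Nat.count P N → ∃ x ≤ N, Nat.count P x = i := by
      intro N
      induction N with
      | zero => intro i hi; exact ⟨0, le_rfl, by simp at hi ⊢; omega⟩
      | succ N ih =>
        intro i hi
        by_cases h : i ≤ Nat.count P N
        · obtain ⟨x, hx, h⟩ := ih i h
          exact ⟨x, by omega, h⟩
        · refine ⟨N + 1, le_rfl, ?_⟩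
          rw [Nat.count_succ] at hi ⊢
          split_ifs at hi ⊢ <;> omega
    intro i hi
    obtain ⟨x, hx, h⟩ := key (n - 1) i (by omega)
    exact ⟨x, by omega, h⟩

theorem count_eq_count_imp {P : ℕ → Prop} [DecidablePred P] {i j k : ℕ}
    (h : Nat.count P i = Nat.count P j) (hik : i ≤ k) (hkj : k < j) : ¬ P k := by
  intro hP
  have h1 := Nat.count_strict_mono hP hkj
  have h2 := Nat.count_monotone P hik
  omega

/-- Exits from `U` and entries into it alternate, beginning with an exit. -/
theorem count_descents_eq {U : ℕ → Prop} [DecidablePred U] (h0 : U 0) (N : ℕ) :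
    Nat.count (fun k => U k ∧ ¬ U (k + 1)) N =
      Nat.count (fun k => ¬ U k ∧ U (k + 1)) N + if U N then 0 else 1 := by
  induction N with
  | zero => simp [h0]
  | succ N ih =>
    rw [Nat.count_succ, Nat.count_succ, ih]
    by_cases h1 : U N <;> by_cases h2 : U (N + 1) <;> simp [h1, h2]

theorem count_or_succ_eq {U : ℕ → Prop} [DecidablePred U] (N : ℕ) :
    Nat.count (fun k => U k ∨ U (k + 1)) N =
      Nat.count (fun k => U (k + 1)) N + Nat.count (fun k => U k ∧ ¬ U (k + 1)) N := by
  induction N with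
  | zero => simp
  | succ N ih =>
    rw [Nat.count_succ, Nat.count_succ, Nat.count_succ, ih]
    by_cases h1 : U N <;> by_cases h2 : U (N + 1) <;> simp [h1, h2] <;> omega

variable {V : Type u} {G : SimpleGraph V} {n : ℕ} {p : ℕ → V} {U : ℕ → Prop}

open Classical in
/-- Edges between two rotated first vertices, as increasing pairs of positions. -/
noncomputable def innerPairs (G : SimpleGraph V) (n : ℕ) (p : ℕ → V) (U : ℕ → Prop) :
    Finset (ℕ × ℕ) :=
  {e ∈ Finset.range n ×ˢ Finset.range n | (U e.1 ∧ U e.2 ∧ e.1 < e.2) ∧ G.Adj (p e.1) (p e.2)}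

open Classical in
/-- Edges from a rotated first vertex to another vertex. -/
noncomputable def outerPairs (G : SimpleGraph V) (n : ℕ) (p : ℕ → V) (U : ℕ → Prop) :
    Finset (ℕ × ℕ) :=
  {e ∈ Finset.range n ×ˢ Finset.range n | (U e.1 ∧ ¬ U e.2) ∧ G.Adj (p e.1) (p e.2)}

theorem mem_innerPairs {i j : ℕ} : (i, j) ∈ G.innerPairs n p U ↔
    i < n ∧ j < n ∧ U i ∧ U j ∧ i < j ∧ G.Adj (p i) (p j) := by
  simp [innerPairs, and_assoc]

theorem mem_outerPairs {i j : ℕ} : (i, j) ∈ G.outerPairs n p U ↔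
    i < n ∧ j < n ∧ U i ∧ ¬ U j ∧ G.Adj (p i) (p j) := by
  simp [outerPairs, and_assoc]

namespace IsRotationSystem

open Classical in
-- Sum the degrees over `U`: all neighbours lie on the cycle, and an edge inside `U` is counted
-- twice.
theorem mul_card_le [Fintype V] [DecidableRel G.Adj] (hR : G.IsRotationSystem n p U) {d : ℕ}
    (hG : ∀ v, d ≤ G.degree v) : d * {i ∈ Finset.range n | U i}.card ≤
      2 * (G.innerPairs n p U).card + (G.outerPairs n p U).card := by
  set A : Finset ℕ := {i ∈ Finset.range n | U i} with hA
  let nb : ℕ → Finset ℕ := fun i => {j ∈ Finset.range n | G.Adj (p i) (p j)}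
  have h1 : d * A.card ≤ (A.sigma nb).card := by
    rw [Finset.card_sigma, mul_comm, ← smul_eq_mul]
    refine Finset.card_nsmul_le_sum _ _ _ fun i hi => ?_
    rw [hA, Finset.mem_filter, Finset.mem_range] at hi
    exact (hG (p i)).trans (degree_le_card_filter (hR.closed i hi.1 hi.2))
  set I := G.innerPairs n p U
  set O := G.outerPairs n p U
  have h2 : (A.sigma nb).card ≤ ((I ∪ I.image Prod.swap) ∪ O).card := by
    refine Finset.card_le_card_of_injOn (fun e => (e.1, e.2)) ?_ ?_
    · rintro ⟨i, j⟩ h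
      simp only [Finset.coe_sigma, Set.mem_sigma_iff, Finset.mem_coe, hA, nb, Finset.mem_filter,
        Finset.mem_range] at h
      obtain ⟨⟨hi, hUi⟩, hj, hadj⟩ := h
      simp only [Finset.mem_coe, Finset.mem_union]
      by_cases hUj : U j
      · left
        rcases lt_trichotomy i j with hlt | rfl | hlt
        · exact .inl (mem_innerPairs.2 ⟨hi, hj, hUi, hUj, hlt, hadj⟩)
        · exact (hadj.ne rfl).elim
        · exact .inr (Finset.mem_image.2 ⟨(j, i),
            mem_innerPairs.2 ⟨hj, hi, hUj, hUi, hlt, hadj.symm⟩, rfl⟩)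
      · exact .inr (mem_outerPairs.2 ⟨hi, hj, hUi, hUj, hadj⟩)
    · rintro ⟨i, j⟩ _ ⟨i', j'⟩ _ h
      simp only [Prod.mk.injEq] at h
      obtain ⟨rfl, rfl⟩ := h
      rfl
  have h3 := Finset.card_union_le (I ∪ I.image Prod.swap) O
  have h4 := Finset.card_union_le I (I.image Prod.swap)
  have h5 : (I.image Prod.swap).card ≤ I.card := Finset.card_image_le
  omega

open Classical in
-- The predecessors of the neighbours of `p 0` lie in `U`. This makes the contracted paths long
-- enough.
theorem degree_le_card [Fintype V] [DecidableRel G.Adj] (hR : G.IsRotationSystem n p U) :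
    G.degree (p 0) ≤ {i ∈ Finset.range n | U i}.card := by
  refine (degree_le_card_filter (hR.closed 0 hR.pos hR.zero)).trans ?_
  have hne : ∀ j, G.Adj (p 0) (p j) → j ≠ 0 := by
    rintro j h rfl
    exact h.ne rfl
  refine Finset.card_le_card_of_injOn (fun j => j - 1) ?_ ?_
  · intro j hj
    simp only [Finset.coe_filter, Set.mem_ofPred_eq, Finset.mem_range] at hj ⊢
    have := hne j hj.2
    refine ⟨by omega, hR.pred (j - 1) (by omega) ?_⟩
    rw [Nat.sub_add_cancel (by omega)]
    exact hj.2
  · intro i hi j hj h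
    simp only [Finset.coe_filter, Set.mem_ofPred_eq, Finset.mem_range] at hi hj h
    have := hne i hi.2
    have := hne j hj.2
    omega

/-- Contracting every maximal run of positions outside `U` to a point loses no edge at `U`. -/
theorem card_pairs_le_contract_runs [DecidablePred U] (hR : G.IsRotationSystem n p U) :
    (G.innerPairs n p U).card + (G.outerPairs n p U).card ≤
      (((G.comap p).contractAlong n (Nat.count fun k => U k ∨ U (k + 1))).edgePairs
        (Nat.count (fun k => U k ∨ U (k + 1)) (n - 1) + 1)).card := by
  classical
  obtain ⟨g, hg⟩ : ∃ g, g = Nat.count fun k => U k ∨ U (k + 1) := ⟨_, rfl⟩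
  have hconst : ∀ i j, i ≤ j → g i = g j → i = j ∨ ∀ k, i ≤ k → k ≤ j → ¬ U k := by
    intro i j hij h
    rcases hij.eq_or_lt with rfl | hlt
    · exact .inl rfl
    · refine .inr fun k hik hkj hU => ?_
      rw [hg] at h
      rcases hkj.eq_or_lt with rfl | hkj
      · refine count_eq_count_imp h (k := k - 1) (by omega) (by omega) (.inr ?_)
        rwa [Nat.sub_add_cancel (by omega)]
      · exact count_eq_count_imp h hik hkj (.inl hU)
  have hinj : ∀ i j, U i → g i = g j → i = j := by
    intro i j hi h
    rcases le_total i j with hij | hij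
    · exact (hconst i j hij h).elim id fun h => (h i le_rfl hij hi).elim
    · exact (hconst j i hij h.symm).elim Eq.symm fun h => (h i hij le_rfl hi).elim
  have hrun : ∀ m i j, m < n → i < n → j < n → U m → g i = g j → G.Adj (p m) (p i) →
      G.Adj (p m) (p j) → i = j := by
    intro m i j hm hi hj hU h hmi hmj
    rcases le_total i j with hij | hij
    · exact (hconst i j hij h).elim id fun h => hR.run i j hij hj h m hm hU hmi hmj
    · exact (hconst j i hij h.symm).elim Eq.symm
        fun h => (hR.run j i hij hi h m hm hU hmj hmi).symm
  have hlt := (isIntervalMap_count (fun k => U k ∨ U (k + 1)) hR.pos).lt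
  rw [← hg] at hlt ⊢
  have hdisj : Disjoint (G.innerPairs n p U) (G.outerPairs n p U) := by
    rw [Finset.disjoint_left]
    rintro ⟨i, j⟩ h h'
    exact (mem_outerPairs.1 h').2.2.2.1 (mem_innerPairs.1 h).2.2.2.1
  rw [← Finset.card_union_of_disjoint hdisj]
  have hmem : ∀ i j, (i, j) ∈ G.innerPairs n p U ∪ G.outerPairs n p U →
      i < n ∧ j < n ∧ U i ∧ (U j → i < j) ∧ G.Adj (p i) (p j) := by
    intro i j h
    rcases Finset.mem_union.1 h with h | h
    · have h := mem_innerPairs.1 h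
      exact ⟨h.1, h.2.1, h.2.2.1, fun _ => h.2.2.2.2.1, h.2.2.2.2.2⟩
    · have h := mem_outerPairs.1 h
      exact ⟨h.1, h.2.1, h.2.2.1, fun h' => (h.2.2.2.1 h').elim, h.2.2.2.2⟩
  -- An outer pair starts at its `U` end, whatever the order of the positions, hence `min` and
  -- `max`.
  refine Finset.card_le_card_of_injOn
    (fun e => (min (g e.1) (g e.2), max (g e.1) (g e.2))) ?_ ?_
  · rintro ⟨i, j⟩ h
    obtain ⟨hi, hj, hUi, -, hadj⟩ := hmem i j h
    have hne : g i ≠ g j := by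
      intro h
      obtain rfl := hinj i j hUi h
      exact hadj.ne rfl
    have h1 := hlt i hi
    have h2 := hlt j hj
    simp only [Finset.mem_coe, mem_edgePairs]
    rcases lt_or_gt_of_ne hne with h | h
    · rw [min_eq_left h.le, max_eq_right h.le]
      exact ⟨h, h2, h.ne, i, hi, j, hj, rfl, rfl, hadj⟩
    · rw [min_eq_right h.le, max_eq_left h.le]
      exact ⟨h, h1, h.ne, j, hj, i, hi, rfl, rfl, hadj.symm⟩
  · rintro ⟨i, j⟩ h ⟨i', j'⟩ h' he
    obtain ⟨hi, hj, hUi, hUj, hadj⟩ := hmem i j h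
    obtain ⟨hi', hj', hUi', hUj', hadj'⟩ := hmem i' j' h'
    simp only [Prod.mk.injEq] at he
    have hcases : (g i = g i' ∧ g j = g j') ∨ (g i = g j' ∧ g i' = g j) := by omega
    rcases hcases with ⟨h1, h2⟩ | ⟨h1, h2⟩
    · obtain rfl := hinj i i' hUi h1
      obtain rfl := hrun i j j' hi hj hj' hUi h2 hadj hadj'
      rfl
    · obtain rfl := hinj i j' hUi h1
      obtain rfl := hinj i' j hUi' h2
      have := hUj hUi'
      have := hUj' hUi
      omega

/-- Absorbing every maximal run of positions outside `U` into the preceding element of `U`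
creates a new edge for each run followed by an element of `U`. -/
theorem card_pairs_add_ascents_le_contract [DecidablePred U] (hR : G.IsRotationSystem n p U) :
    (G.innerPairs n p U).card + Nat.count (fun k => ¬ U k ∧ U (k + 1)) (n - 1) ≤
      (((G.comap p).contractAlong n (Nat.count fun k => U (k + 1))).edgePairs
        (Nat.count (fun k => U (k + 1)) (n - 1) + 1)).card := by
  classical
  obtain ⟨g, hg⟩ : ∃ g, g = Nat.count fun k => U (k + 1) := ⟨_, rfl⟩
  have hconst : ∀ i j, g i = g j → ∀ k, i < k → k ≤ j → ¬ U k := by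
    intro i j h k hik hkj hU
    rw [hg] at h
    refine count_eq_count_imp h (k := k - 1) (by omega) (by omega) ?_
    rwa [Nat.sub_add_cancel (by omega)]
  have hinj : ∀ i j, U i → U j → g i = g j → i = j := by
    intro i j hi hj h
    rcases lt_trichotomy i j with hij | rfl | hij
    · exact (hconst i j h j hij le_rfl hj).elim
    · rfl
    · exact (hconst j i h.symm i hij le_rfl hi).elim
  have hlt := (isIntervalMap_count (fun k => U (k + 1)) hR.pos).lt
  have hmono := (isIntervalMap_count (fun k => U (k + 1)) hR.pos).mono
  have hsucc : ∀ i, U (i + 1) → g (i + 1) = g i + 1 := by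
    intro i hi
    rw [hg, Nat.count_succ, if_pos hi]
  rw [← hg] at hlt hmono ⊢
  rw [Nat.count_eq_card_filter_range]
  set X : Finset ℕ := {k ∈ Finset.range (n - 1) | ¬ U k ∧ U (k + 1)} with hX
  have hmemX : ∀ k, k ∈ X ↔ k < n - 1 ∧ ¬ U k ∧ U (k + 1) := by
    intro k
    rw [hX, Finset.mem_filter, Finset.mem_range]
  have hI : ((G.innerPairs n p U).image fun e => (g e.1, g e.2)).card =
      (G.innerPairs n p U).card := by
    refine Finset.card_image_of_injOn ?_
    rintro ⟨i, j⟩ h ⟨i', j'⟩ h' he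
    have h := mem_innerPairs.1 h
    have h' := mem_innerPairs.1 h'
    simp only [Prod.mk.injEq] at he ⊢
    exact ⟨hinj _ _ h.2.2.1 h'.2.2.1 he.1, hinj _ _ h.2.2.2.1 h'.2.2.2.1 he.2⟩
  have hXc : (X.image fun k => (g k, g (k + 1))).card = X.card := by
    refine Finset.card_image_of_injOn ?_
    intro k hk k' hk' he
    simp only [Prod.mk.injEq] at he
    have := hinj _ _ ((hmemX k).1 hk).2.2 ((hmemX k').1 hk').2.2 he.2
    omega
  rw [← hI, ← hXc, ← Finset.card_union_of_disjoint]
  · refine Finset.card_le_card ?_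
    intro e he
    rcases Finset.mem_union.1 he with he | he
    · obtain ⟨⟨i, j⟩, h, rfl⟩ := Finset.mem_image.1 he
      obtain ⟨hi, hj, hUi, hUj, hij, hadj⟩ := mem_innerPairs.1 h
      have hne : g i ≠ g j := fun h => hij.ne (hinj i j hUi hUj h)
      exact mem_edgePairs.2 ⟨lt_of_le_of_ne (hmono hij.le) hne, hlt j hj, hne, i, hi, j, hj, rfl,
        rfl, hadj⟩
    · obtain ⟨k, hk, rfl⟩ := Finset.mem_image.1 he
      obtain ⟨hkn, hUk, hUk'⟩ := (hmemX k).1 hk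
      have := hsucc k hUk'
      exact mem_edgePairs.2 ⟨by omega, hlt _ (by omega), by omega, k, by omega, k + 1, by omega,
        rfl, rfl, hR.adj k (by omega)⟩
  -- An inner edge with the same image would join an element of `U` to the vertex just after the run
  -- that follows it, which `not_adj` forbids.
  · rw [Finset.disjoint_left]
    intro e he he'
    obtain ⟨⟨i, j⟩, h, rfl⟩ := Finset.mem_image.1 he
    obtain ⟨k, hk, hke⟩ := Finset.mem_image.1 he'
    obtain ⟨hi, hj, hUi, hUj, hij, hadj⟩ := mem_innerPairs.1 h
    obtain ⟨hkn, hUk, hUk'⟩ := (hmemX k).1 hk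
    simp only [Prod.mk.injEq] at hke
    obtain rfl := hinj _ _ hUj hUk' hke.2.symm
    have hik : i ≠ k := by rintro rfl; exact hUk hUi
    exact hR.not_adj i (k + 1) (by omega) hj hUi
      (fun s h1 h2 => hconst i k hke.1.symm s h1 (by omega)) hadj

end IsRotationSystem

theorem isCyclicMinor_five_of_eight_le_degree [Fintype V] [Nonempty V] [DecidableRel G.Adj]
    (hG : ∀ v, 8 ≤ G.degree v) : (⊤ : SimpleGraph (Fin 5)).IsCyclicMinor G := by
  classical
  obtain ⟨n, p, U, hR⟩ := exists_isRotationSystem (G := G) fun v =>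
    (G.degree_pos_iff_exists_adj v).1 (by have := hG v; omega)
  have hdeg := hR.mul_card_le hG
  have hm := (hG (p 0)).trans hR.degree_le_card
  have hruns := hR.card_pairs_le_contract_runs
  have hasc := hR.card_pairs_add_ascents_le_contract
  rw [← Nat.count_eq_card_filter_range] at hdeg hm
  have hn := hR.pos
  have hmn : Nat.count U n ≤ n := Nat.count_le _
  have hm1 : Nat.count U n = Nat.count (fun k => U (k + 1)) (n - 1) + 1 := by
    obtain ⟨k, rfl⟩ : ∃ k, n = k + 1 := ⟨n - 1, by omega⟩
    rw [Nat.count_succ', if_pos hR.zero]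
    rfl
  have hor := count_or_succ_eq (U := U) (n - 1)
  have hdesc := count_descents_eq hR.zero (n - 1)
  have hdesc' : Nat.count (fun k => U k ∧ ¬ U (k + 1)) (n - 1) ≤ Nat.count U n :=
    (Nat.count_mono_left fun k _ h => h.1).trans (Nat.count_monotone U (by omega))
  have hcyc : G.IsCyclicSeq n p := ⟨by omega, hR.inj, hR.adj, hR.close⟩
  have hfin : ∀ P : ℕ → Prop, ∀ [DecidablePred P], 3 ≤ Nat.count P (n - 1) + 1 →
      3 * (Nat.count P (n - 1) + 1) ≤ (((G.comap p).contractAlong n (Nat.count P)).edgePairs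
        (Nat.count P (n - 1) + 1)).card + 5 → (⊤ : SimpleGraph (Fin 5)).IsCyclicMinor G := by
    intro P _ h3 h
    have hP := isIntervalMap_count P hn
    obtain ⟨f, hf⟩ := exists_isCliqueModel_five _ h3 (hP.contractAlong_adj_succ hR.adj) h
    exact hcyc.isCyclicMinor (hf.comp hP)
  by_contra hcon
  -- Without `K₅`, both contractions have at most `3N - 6` edges on their `N` vertices; with the
  -- degree sum and `D ≤ A + 1`, `D ≤ m`, this is contradictory.
  have h1 : ¬ _ := fun h => hcon (hfin (fun k => U k ∨ U (k + 1)) (by omega) h)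
  have h2 : ¬ _ := fun h => hcon (hfin (fun k => U (k + 1)) (by omega) h)
  split_ifs at hdesc <;> omega

end SimpleGraph

/-- `f(3) = 2`, `f(4) = 3`, and `f(5)` exists and is at most `8`. -/
theorem lemmal :
    IsLeast (cyclicCliqueForcing.{u} 3) 2 ∧
    IsLeast (cyclicCliqueForcing.{u} 4) 3 ∧
    ∃ δ : ℕ, IsLeast (cyclicCliqueForcing.{u} 5) δ ∧ δ ≤ 8 := by
  have h5 : 8 ∈ cyclicCliqueForcing.{u} 5 := fun V _ _ G _ h =>
    SimpleGraph.isCyclicMinor_five_of_eight_le_degree fun v => h.trans (G.minDegree_le_degree v)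
  refine ⟨⟨fun V _ _ G _ h => ?_, fun δ h => ?_⟩, ⟨fun V _ _ G _ h => ?_, fun δ h => ?_⟩,
    sInf (cyclicCliqueForcing.{u} 5), ⟨Nat.sInf_mem ⟨8, h5⟩, fun δ h => Nat.sInf_le h⟩,
    Nat.sInf_le h5⟩
  · exact SimpleGraph.isCyclicMinor_three_of_two_le_degree fun v =>
      h.trans (G.minDegree_le_degree v)
  · exact pred_le_of_mem_cyclicCliqueForcing h (by omega)
  · exact SimpleGraph.isCyclicMinor_four_of_three_le_degree fun v =>
      h.trans (G.minDegree_le_degree v)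
  · exact pred_le_of_mem_cyclicCliqueForcing h (by omega)
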